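/- Let $m,n,p\ge 0$ be integers ($m$ agents, shared design vectors in $\mathbb R^n$ with the Euclidean norm). Consider the special quadratic design program $$\min_{z}\ \sum_{i=1}^m c_i(k)\,\|z_i-y_i-t_i(k)\|^2\quad\text{s.t.}\quad y_i=\sum_{r=1}^m b_{ri}(k)z_r,\qquad \sum_{r=1}^m(\lambda_r z_r+\mu_r y_r)\le b,\qquad z_i\in X_i,$$ with $c_i(k),b_{ri}(k)\in\mathbb R$, $t_i(k)\in\mathbb R^n$, linear maps $\lambda_r,\mu_r:\mathbb R^n\to\mathbb R^p$, $b\in\mathbb R^p$ and $X_i\subseteq\mathbb R^n$, in which the agents have to agree on one design vector $x$ ($z_1=\dots=z_m=x$). Thus agent $i$ has the local objective $f_i(x)=c_i(k)\|x-\sum_r b_{ri}(k)x-t_i(k)\|^2$ and the constraint set $Z_i$ of those $x\in X_i$ that satisfy the coupled inequality at $z_1=\dots=z_m=x$. The data may carry the time index $k$, but the optimization problem does not depend on it: $f_i$ and $Z_i$ are the same for all $k$. Each $f_i$ is convex, and $Z=\bigcap_i Z_i$ is nonempty. Let $Z^*$ be the set of minimizers of $\sum_i f_i$ over $Z$. Let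 $a_{ij}(k)$ be weights, let $E_k$ be the set of pairs $(j,i)$ such that agent $j$ communicates with agent $i$ at time $k$, and assume: 1. (Weights rule) there is $\eta\in(0,1)$ such that for all $k$ and $i$: $a_{ii}(k)\ge\eta$; for $j\ne i$, $a_{ij}(k)\ge\eta$ if $(j,i)\in E_k$ and $a_{ij}(k)=0$ otherwise; and $\sum_j a_{ij}(k)=1$. 2. (Double stochasticity) $a_{ij}(k)\ge 0$, $\sum_j a_{ij}(k)=1$ for all $i,k$, and $\sum_i a_{ij}(k)=1$ for all $j,k$. 3. (Connectivity and symmetry) the graph on the agents whose edge set $E_\infty$ consists of the pairs that lie in $E_k$ for infinitely many $k$ is connected (any agent can be reached from any other along $E_\infty$), and $a_{ij}(k)=a_{ji}(k)$ for all $i,j,k$. 4. (Bounded intercommunication intervals) for every $(i,j)\in E_\infty$ there is $B$ such that $(i,j)\in E_t\cup E_{t+1}\cup\dots\cup E_{t+B-1}$ for all $t$. 5. (Same constraint set) $Z_1=\dots=Z_m$ is one closed convex set, on which the subgradients of the $f_i$ are bounded: there is $L>0$ with $\|d\|\le L$ for all $i$, all $x$ in this set and all $d\in\partial f_i(x)$.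 Let the step sizes $\alpha_i(k)>0$ satisfy $\sum_k\alpha_i(k)=\infty$ and $\sum_k\alpha_i(k)^2<\infty$ for every $i$ (for example, one common sequence $\alpha_k$). Put $b_i'(k)=1-\sum_r b_{ri}(k)$ and $$a_{ij}'(k)=a_{ij}(k)-2\alpha_i(k)c_j(k)b_j'(k)^2,$$ and let the iterates $z_i(k)\in\mathbb R^n$, with arbitrary initial points, be generated by the interleaved collaborative design algorithm $$z_i(k+1)=P_{Z_i}\Big[\sum_{j=1}^m\big(a_{ij}'(k)z_j(k)+2\alpha_i(k)c_j(k)b_j'(k)t_j(k)\big)\Big] =P_{Z_i}\Big[\sum_{j=1}^m a_{ij}(k)z_j(k)-\alpha_i(k)\sum_{j=1}^m\nabla f_j(z_j(k))\Big],$$ where $P_{Z_i}$ is the Euclidean projection onto $Z_i$. Then there is an optimal point $z^*\in Z^*$ such that $\lim_{k\to\infty}\|z_i(k)-z^*\|=0$ for all $i$. -/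

import Mathlib

open Filter Topology

/-- The Euclidean space `ℝⁿ` of shared design vectors. -/
abbrev DesignVec (n : ℕ) : Type := EuclideanSpace ℝ (Fin n)

/-- `q` is a (Euclidean) projection of `x` onto `S`: a point of `S` nearest to `x`.
For a nonempty closed convex `S` it exists and is unique. -/
def IsProjectionOnto {n : ℕ} (S : Set (DesignVec n)) (x q : DesignVec n) : Prop :=
  q ∈ S ∧ ∀ w ∈ S, ‖x - q‖ ≤ ‖x - w‖

/-- The subdifferential `∂f(x)` of a function `f : ℝⁿ → ℝ`. -/
def subgradients {n : ℕ} (f : DesignVec n → ℝ) (x : DesignVec n) : Set (DesignVec n) :=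
  {d | ∀ w, f x + inner ℝ d (w - x) ≤ f w}

/-! ### The special quadratic design program -/

/-- Data of the special quadratic design programming problem with `m` agents, shared design
vectors in `ℝⁿ` and `p` coupled linear inequalities:
minimize `∑ i, c i (z i - y i - t i)²` subject to `y i = ∑ r, b r i z r`,
`∑ r, (lam r (z r) + mu r (y r)) ≤ bound` and the local restriction `z i ∈ X i` of each agent.
The first argument of `c`, `b`, `t` is the time index. -/
structure SpecialQDP (m n p : ℕ) where
  c : ℕ → Fin m → ℝ
  b : ℕ → Fin m → Fin m → ℝ
  t : ℕ → Fin m → DesignVec n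
  lam : Fin m → DesignVec n →ₗ[ℝ] (Fin p → ℝ)
  mu : Fin m → DesignVec n →ₗ[ℝ] (Fin p → ℝ)
  bound : Fin p → ℝ
  X : Fin m → Set (DesignVec n)

namespace SpecialQDP

variable {m n p : ℕ}

/-- The coupling variables `y i = ∑ r, b r i z r`. -/
def coupling (P : SpecialQDP m n p) (k : ℕ) (z : Fin m → DesignVec n) (i : Fin m) :
    DesignVec n :=
  ∑ r, P.b k r i • z r

/-- The `i`-th summand `c i ‖z i - y i - t i‖²` of the objective. -/
noncomputable def agentCost (P : SpecialQDP m n p) (k : ℕ) (i : Fin m) (z : Fin m → DesignVec n) : ℝ :=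
  P.c k i * ‖z i - P.coupling k z i - P.t k i‖ ^ 2

/-- The coupled linear inequalities `∑ r, (lam r (z r) + mu r (y r)) ≤ bound`. -/
def LinearConstraint (P : SpecialQDP m n p) (k : ℕ) (z : Fin m → DesignVec n) : Prop :=
  ∑ r, (P.lam r (z r) + P.mu r (P.coupling k z r)) ≤ P.bound

/-- The local objective `f i : ℝⁿ → ℝ` of agent `i` as a function of the common design vector
`x` on which the agents have to agree, i.e. at `z 1 = ⋯ = z m = x`. -/
noncomputable def localObjective (P : SpecialQDP m n p) (k : ℕ) (i : Fin m) (x : DesignVec n) : ℝ :=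
  P.agentCost k i fun _ => x

/-- The constraint set `Z i` of agent `i`, as a set of common design vectors. -/
def constraintSet (P : SpecialQDP m n p) (k : ℕ) (i : Fin m) : Set (DesignVec n) :=
  {x | x ∈ P.X i ∧ P.LinearConstraint k fun _ => x}

/-- The optimal solution set: the minimizers of `∑ i, f i` over `⋂ i, Z i`. -/
def optimalSet (P : SpecialQDP m n p) (k : ℕ) : Set (DesignVec n) :=
  {x | x ∈ ⋂ i, P.constraintSet k i ∧
    ∀ w ∈ ⋂ i, P.constraintSet k i, ∑ i, P.localObjective k i x ≤ ∑ i, P.localObjective k i w}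

/-- `b' i = 1 - ∑ r, b r i`. -/
def bPrime (P : SpecialQDP m n p) (k : ℕ) (i : Fin m) : ℝ :=
  1 - ∑ r, P.b k r i

/-- The modified weights `a' i j = a i j - 2 α i c j (b' j)²`. -/
def modifiedWeight (P : SpecialQDP m n p) (a : ℕ → Fin m → Fin m → ℝ) (α : ℕ → Fin m → ℝ)
    (k : ℕ) (i j : Fin m) : ℝ :=
  a k i j - 2 * α k i * P.c k j * P.bPrime k j ^ 2

/-- The part of the gradient `∑ j, 2 c j b' j (b' j z j - t j)` that does not involve `z`. -/
def constantDirection (P : SpecialQDP m n p) (k : ℕ) : DesignVec n :=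
  - ∑ j, (2 * P.c k j * P.bPrime k j) • P.t k j

end SpecialQDP

/-! ### The interleaved collaborative design algorithm -/

/-- The interleaved algorithm
`z i (k+1) = P_{S i} [σ i (k) ∑ j, a i j (k) z j (k) - γ i (k) d i (k)]`. -/
def IsInterleavedSequence {m n : ℕ} (S : ℕ → Fin m → Set (DesignVec n)) (σ : ℕ → Fin m → ℝ)
    (a : ℕ → Fin m → Fin m → ℝ) (γ : ℕ → Fin m → ℝ) (d : ℕ → Fin m → DesignVec n)
    (z : ℕ → Fin m → DesignVec n) : Prop :=
  ∀ k i, IsProjectionOnto (S k i) (σ k i • ∑ j, a k i j • z k j - γ k i • d k i) (z (k + 1) i)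

/-- The interleaved algorithm for the special quadratic design program, written with the
modified weights:
`z i (k+1) = P_{Z i} [∑ j, (a' i j (k) z j (k) + 2 α i (k) c j (k) b' j (k) t j (k))]`. -/
def SpecialQDP.IsGenerated {m n p : ℕ} (P : SpecialQDP m n p)
    (a : ℕ → Fin m → Fin m → ℝ) (α : ℕ → Fin m → ℝ) (z : ℕ → Fin m → DesignVec n) : Prop :=
  IsInterleavedSequence P.constraintSet (fun _ _ => 1) (P.modifiedWeight a α) α
    (fun k _ => P.constantDirection k) z

theorem SpecialQDP.localObjective_eq {m n p : ℕ} (P : SpecialQDP m n p) (k : ℕ) (i : Fin m)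
    (x : DesignVec n) :
    P.localObjective k i x = P.c k i * ‖P.bPrime k i • x - P.t k i‖ ^ 2 := by
  simp [localObjective, agentCost, coupling, bPrime, sub_smul, Finset.sum_smul]

theorem SpecialQDP.hasGradientAt_localObjective {m n p : ℕ} (P : SpecialQDP m n p) (k : ℕ)
    (i : Fin m) (x : DesignVec n) :
    HasGradientAt (P.localObjective k i)
      ((2 * P.c k i * P.bPrime k i) • (P.bPrime k i • x - P.t k i)) x := by
  have h0 : P.localObjective k i
      = fun x => P.c k i * ‖P.bPrime k i • x - P.t k i‖ ^ 2 := by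
    funext x
    exact P.localObjective_eq k i x
  rw [h0, hasGradientAt_iff_hasFDerivAt]
  have h1 : HasFDerivAt (fun x : DesignVec n => P.bPrime k i • x - P.t k i)
      (P.bPrime k i • ContinuousLinearMap.id ℝ (DesignVec n)) x :=
    ((hasFDerivAt_id x).const_smul (P.bPrime k i)).sub_const _
  refine ((h1.norm_sq).const_mul (P.c k i)).congr_fderiv ?_
  ext1 v
  simp
  ring

/-- The generated sequences are exactly those of the interleaved algorithm with the original
weights `a`, step sizes `α` and the gradient direction `∑ j, ∇ f j (z j)`. -/
theorem SpecialQDP.isGenerated_iff_gradient {m n p : ℕ} (P : SpecialQDP m n p)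
    (a : ℕ → Fin m → Fin m → ℝ) (α : ℕ → Fin m → ℝ) (z : ℕ → Fin m → DesignVec n) :
    P.IsGenerated a α z ↔
      IsInterleavedSequence P.constraintSet (fun _ _ => 1) a α
        (fun k _ => ∑ j, gradient (P.localObjective k j) (z k j)) z := by
  have key : ∀ k i,
      (1 : ℝ) • ∑ j, P.modifiedWeight a α k i j • z k j - α k i • P.constantDirection k
        = (1 : ℝ) • ∑ j, a k i j • z k j
          - α k i • ∑ j, gradient (P.localObjective k j) (z k j) := by
    intro k i
    simp only [(P.hasGradientAt_localObjective k _ _).gradient, modifiedWeight,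
      constantDirection, one_smul, Finset.smul_sum, smul_neg, sub_neg_eq_add]
    rw [← Finset.sum_add_distrib, ← Finset.sum_sub_distrib]
    refine Finset.sum_congr rfl fun j _ => ?_
    module
  unfold IsGenerated IsInterleavedSequence
  simp only [key]

/-! ### Assumptions on the information exchange

`E k j i` means that agent `j` communicates with agent `i` at time `k`. -/

/-- Weights rule. -/
def WeightsRule {m : ℕ} (a : ℕ → Fin m → Fin m → ℝ) (E : ℕ → Fin m → Fin m → Prop) : Prop :=
  ∃ η : ℝ, 0 < η ∧ η < 1 ∧ ∀ k i,
    η ≤ a k i i ∧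
    (∀ j, j ≠ i → (E k j i → η ≤ a k i j) ∧ (¬ E k j i → a k i j = 0)) ∧
    ∑ j, a k i j = 1

/-- The set `E_∞` of the edges that are used infinitely often. -/
def edgesInfty {m : ℕ} (E : ℕ → Fin m → Fin m → Prop) (j i : Fin m) : Prop :=
  ∃ᶠ k in atTop, E k j i

/-- Connectivity and symmetry. -/
def ConnectivitySymmetry {m : ℕ} (a : ℕ → Fin m → Fin m → ℝ)
    (E : ℕ → Fin m → Fin m → Prop) : Prop :=
  (∀ j i, Relation.ReflTransGen (edgesInfty E) j i) ∧ ∀ k i j, a k i j = a k j i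

/-- Bounded intercommunication intervals. -/
def BoundedIntercommunication {m : ℕ} (E : ℕ → Fin m → Fin m → Prop) : Prop :=
  ∀ i j, edgesInfty E i j → ∃ B : ℕ, ∀ t, ∃ s, t ≤ s ∧ s < t + B ∧ E s i j

/-- Double stochasticity. -/
def DoublyStochasticWeights {m : ℕ} (a : ℕ → Fin m → Fin m → ℝ) : Prop :=
  (∀ k i j, 0 ≤ a k i j) ∧ (∀ k i, ∑ j, a k i j = 1) ∧ (∀ k j, ∑ i, a k i j = 1)

/-- Same constraint set: all `Z i` equal one closed convex set `Z`, on which the subgradients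
of all `f i` are bounded. -/
def SameConstraintSet {m n : ℕ} (f : Fin m → DesignVec n → ℝ)
    (Zs : Fin m → Set (DesignVec n)) : Prop :=
  ∃ Z : Set (DesignVec n), IsClosed Z ∧ Convex ℝ Z ∧ (∀ i, Zs i = Z) ∧
    ∃ L : ℝ, 0 < L ∧ ∀ i, ∀ x ∈ Z, ∀ d ∈ subgradients (f i) x, ‖d‖ ≤ L

/-! In gradient form agent `i` replaces `z i` by the projection of `v i - α i • g`, where `v i` is
its weighted mean and `g = ∑ j, ∇f j (z j)` is common to all agents. Hence each agent descends on
the whole objective `F = ∑ j, f j`, up to the disagreement `D = ∑ i, ∑ j, ‖z i - z j‖`, and the step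
sizes may differ between agents.

For `x ∈ Z` let `S = ∑ i, ‖z i - x‖ ^ 2`. The variance identity, the projection inequality and
column stochasticity give `S⁺ + Q + 2 ∑ i, α i (F (v i) - F x) ≤ S + c A D + c A ^ 2`, where `Q` is
the total variance of the averaging and `A = ∑ i, α i` (`projected_consensus_energy`). The term `A
D` is not summable a priori. Connectivity in windows of length `T` bounds `D ^ 2` by the sum of `Q +
A ^ 2` over the preceding window (`projected_consensus_window`), so Young's inequality absorbs it
into `Q` (`summable_of_energy_inequality`).

Thus `∑ D ^ 2 < ∞` and `S` converges for every minimizer `x`. Since `∑ α = ∞`, some subsequence of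
the means of one agent has objective values tending to the minimum; a limit point `x` of that
agent's iterates along it is a minimizer, and `S` for this `x` has limit zero. A minimizer to start
from exists by `SpecialQDP.exists_minimizer`. -/

/-! ### Weighted means and projections -/

/-- The variance identity for a weighted mean. -/
theorem sum_weight_mul_norm_sub_sq {ι V : Type*} [Fintype ι] [NormedAddCommGroup V]
    [InnerProductSpace ℝ V] (a : ι → ℝ) (ha : ∑ j, a j = 1) (x : ι → V) (w : V) :
    ∑ j, a j * ‖x j - w‖ ^ 2 =
      ‖∑ j, a j • x j - w‖ ^ 2 + ∑ j, a j * ‖x j - ∑ l, a l • x l‖ ^ 2 := by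
  set v := ∑ l, a l • x l with hv
  have h1 : ∀ j, a j * ‖x j - w‖ ^ 2 = a j * ‖x j - v‖ ^ 2
      + (2 * inner ℝ (a j • x j - a j • v) (v - w) + a j * ‖v - w‖ ^ 2) := by
    intro j
    have : x j - w = (x j - v) + (v - w) := by abel
    rw [this, norm_add_sq_real, ← smul_sub, inner_smul_left]
    simp
    ring
  have h2 : ∑ j, inner ℝ (a j • x j - a j • v) (v - w) = 0 := by
    rw [← sum_inner, Finset.sum_sub_distrib, ← Finset.sum_smul, ha, ← hv]
    simp
  simp_rw [h1]
  rw [Finset.sum_add_distrib, Finset.sum_add_distrib, ← Finset.mul_sum, h2, ← Finset.sum_mul, ha]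
  ring

/-- A point nearest to `x` in a convex set is at least as close as `x` to the points of the set. -/
theorem IsProjectionOnto.norm_sub_le {n : ℕ} {S : Set (DesignVec n)} {x q w : DesignVec n}
    (h : IsProjectionOnto S x q) (hS : Convex ℝ S) (hw : w ∈ S) : ‖q - w‖ ≤ ‖x - w‖ := by
  have hq : ‖x - q‖ = ⨅ u : S, ‖x - u‖ := by
    have : Nonempty S := ⟨⟨q, h.1⟩⟩
    apply le_antisymm
    · exact le_ciInf fun u => h.2 u u.2
    · exact ciInf_le ⟨0, by rintro _ ⟨u, rfl⟩; exact norm_nonneg _⟩ (⟨q, h.1⟩ : S)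
  have hin := (norm_eq_iInf_iff_real_inner_le_zero hS h.1).1 hq w hw
  have hsq : ‖x - w‖ ^ 2 = ‖x - q‖ ^ 2 + 2 * inner ℝ (x - q) (q - w) + ‖q - w‖ ^ 2 := by
    rw [← norm_add_sq_real]
    congr 2
    abel
  have hneg : inner ℝ (x - q) (q - w) = - inner ℝ (x - q) (w - q) := by
    rw [← inner_neg_right, neg_sub]
  refine le_of_sq_le_sq ?_ (norm_nonneg _)
  nlinarith [sq_nonneg ‖x - q‖]

/-! ### Scalar sequences and energy inequalities -/

/-- A nonnegative sequence that increases by at most a summable sequence converges. -/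
theorem exists_tendsto_of_le_add_summable {S b : ℕ → ℝ} (hS : ∀ k, 0 ≤ S k)
    (hb : Summable b) (h : ∀ k, S (k + 1) ≤ S k + b k) : ∃ l, Tendsto S atTop (𝓝 l) := by
  have hlim := hb.hasSum.tendsto_sum_nat
  obtain ⟨C, hC⟩ := hlim.bddAbove_range
  have hanti : Antitone fun k => S k - ∑ s ∈ Finset.range k, b s := by
    refine antitone_nat_of_succ_le fun k => ?_
    rw [Finset.sum_range_succ]
    linarith [h k]
  have hbdd : BddBelow (Set.range fun k => S k - ∑ s ∈ Finset.range k, b s) := by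
    refine ⟨-C, ?_⟩
    rintro _ ⟨k, rfl⟩
    have := hC ⟨k, rfl⟩
    dsimp only at this ⊢
    linarith [hS k]
  refine ⟨_, ((tendsto_atTop_ciInf hanti hbdd).add hlim).congr fun k => ?_⟩
  ring

/-- Each index lies in at most `T` of the windows `[k, k + T)`, and all windows with `k < N` end by
`N + T`. -/
theorem sum_range_window_le {X : ℕ → ℝ} (hX : ∀ k, 0 ≤ X k) (N T : ℕ) :
    ∑ k ∈ Finset.range N, ∑ u ∈ Finset.range T, X (k + u) ≤
      T * ∑ s ∈ Finset.range (N + T), X s := by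
  rw [Finset.sum_comm, ← nsmul_eq_mul]
  refine (Finset.sum_le_card_nsmul _ _ (∑ s ∈ Finset.range (N + T), X s) fun u hu => ?_).trans
    (by simp)
  rw [Finset.sum_congr rfl fun k _ => by rw [add_comm k u], add_comm N T]
  calc ∑ k ∈ Finset.range N, X (u + k)
      ≤ ∑ s ∈ Finset.range u, X s + ∑ k ∈ Finset.range N, X (u + k) :=
        le_add_of_nonneg_left (Finset.sum_nonneg fun s _ => hX s)
    _ = ∑ s ∈ Finset.range (u + N), X s := (Finset.sum_range_add _ _ _).symm
    _ ≤ _ := Finset.sum_le_sum_of_subset_of_nonneg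
        (Finset.range_mono (by have := Finset.mem_range.1 hu; omega)) fun s _ _ => hX s

/-- An energy inequality whose error term `D` is controlled by the past decrements `Q` and by a
square-summable sequence `A` has summable decrements. -/
theorem summable_of_energy_inequality {S Q G A D : ℕ → ℝ} {c M : ℝ} {T : ℕ}
    (hS : ∀ k, 0 ≤ S k) (hQ : ∀ k, 0 ≤ Q k) (hG : ∀ k, 0 ≤ G k)
    (hc : 0 ≤ c) (hM : 0 ≤ M) (hAsq : Summable fun k => A k ^ 2)
    (henergy : ∀ k, S (k + 1) + Q k + G k ≤ S k + c * (A k * D k) + c * A k ^ 2)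
    (hwindow : ∀ k, D (k + T) ^ 2 ≤ M * ∑ u ∈ Finset.range T, (Q (k + u) + A (k + u) ^ 2)) :
    (Summable fun k => D k ^ 2) ∧ Summable G := by
  set X : ℕ → ℝ := fun k => Q k + A k ^ 2 with hXdef
  have hX : ∀ k, 0 ≤ X k := fun k => add_nonneg (hQ k) (sq_nonneg _)
  set a2 := ∑' k, A k ^ 2 with ha2
  have hA2 : ∀ N, ∑ k ∈ Finset.range N, A k ^ 2 ≤ a2 := fun N =>
    hAsq.sum_le_tsum _ fun k _ => sq_nonneg _
  -- `hwindow` says nothing about the first `T` terms, so they are kept as a constant.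
  set D0 := ∑ k ∈ Finset.range T, D k ^ 2 with hD0
  have hD0n : 0 ≤ D0 := Finset.sum_nonneg fun k _ => sq_nonneg _
  have hMT : 0 ≤ M * T := by positivity
  have hDsum : ∀ N, ∑ k ∈ Finset.range (N + T), D k ^ 2 ≤
      D0 + M * T * ∑ s ∈ Finset.range (N + T), X s := by
    intro N
    rw [add_comm N T, Finset.sum_range_add, mul_assoc]
    gcongr
    calc ∑ k ∈ Finset.range N, D (T + k) ^ 2
        ≤ ∑ k ∈ Finset.range N, M * ∑ u ∈ Finset.range T, X (k + u) :=
          Finset.sum_le_sum fun k _ => by rw [add_comm T k]; exact hwindow k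
      _ ≤ _ := by
          rw [← Finset.mul_sum, add_comm T N]
          exact mul_le_mul_of_nonneg_left (sum_range_window_le hX N T) hM
  -- The weight in Young's inequality: after `D ^ 2` is traded for `Q + A ^ 2` at the cost `M * T`,
  -- at most half of `∑ Q` is used up.
  obtain ⟨ε, hε, hεMT⟩ : ∃ ε : ℝ, 0 < ε ∧ ε * (M * T) ≤ 1 / 2 := by
    refine ⟨1 / (2 * (M * T + 1)), by positivity, ?_⟩
    rw [div_mul_eq_mul_div, div_le_div_iff₀ (by positivity) (by norm_num)]
    linarith
  have hstep : ∀ k, S (k + 1) + Q k + G k ≤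
      S k + ε * D k ^ 2 + (c ^ 2 / (4 * ε) + c) * A k ^ 2 := by
    intro k
    have h1 : c * (A k * D k) ≤ ε * D k ^ 2 + c ^ 2 / (4 * ε) * A k ^ 2 := by
      have h2 : ε * D k ^ 2 + c ^ 2 / (4 * ε) * A k ^ 2 - c * (A k * D k)
          = (2 * ε * D k - c * A k) ^ 2 / (4 * ε) := by
        field_simp
        ring
      have h3 : 0 ≤ (2 * ε * D k - c * A k) ^ 2 / (4 * ε) := by positivity
      linarith
    linarith [henergy k]
  set C := c ^ 2 / (4 * ε) + c with hCdef
  have hC : 0 ≤ C := by positivity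
  have htel : ∀ N, S N + ∑ k ∈ Finset.range N, Q k + ∑ k ∈ Finset.range N, G k ≤
      S 0 + ε * ∑ k ∈ Finset.range N, D k ^ 2 + C * ∑ k ∈ Finset.range N, A k ^ 2 := by
    intro N
    induction N with
    | zero => simp
    | succ N ih =>
      simp only [Finset.sum_range_succ, mul_add]
      linarith [hstep N]
  have hmain : ∀ N, (∑ k ∈ Finset.range (N + T), Q k) / 2 + ∑ k ∈ Finset.range (N + T), G k ≤
      S 0 + ε * D0 + (C + 1 / 2) * a2 := by
    intro N
    have h1 := htel (N + T)
    have h2 := mul_le_mul_of_nonneg_left (hDsum N) hε.le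
    have hXs : ∑ s ∈ Finset.range (N + T), X s =
        ∑ k ∈ Finset.range (N + T), Q k + ∑ k ∈ Finset.range (N + T), A k ^ 2 :=
      Finset.sum_add_distrib
    have hXn : 0 ≤ ∑ s ∈ Finset.range (N + T), X s := Finset.sum_nonneg fun s _ => hX s
    have h3 := mul_le_mul_of_nonneg_right hεMT hXn
    have h4 := mul_le_mul_of_nonneg_left (hA2 (N + T)) hC
    have h5 := hA2 (N + T)
    have h6 := hS (N + T)
    nlinarith
  have hGn : ∀ N, 0 ≤ ∑ k ∈ Finset.range N, G k := fun N => Finset.sum_nonneg fun k _ => hG k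
  have hQn : ∀ N, 0 ≤ ∑ k ∈ Finset.range N, Q k := fun N => Finset.sum_nonneg fun k _ => hQ k
  have hext : ∀ {Y : ℕ → ℝ}, (∀ k, 0 ≤ Y k) → ∀ N,
      ∑ k ∈ Finset.range N, Y k ≤ ∑ k ∈ Finset.range (N + T), Y k := fun hY N =>
    Finset.sum_le_sum_of_subset_of_nonneg (Finset.range_mono (by omega)) fun k _ _ => hY k
  refine ⟨summable_of_sum_range_le (c := D0 + M * T * (2 * (S 0 + ε * D0 + (C + 1 / 2) * a2) + a2))
    (fun k => sq_nonneg _) fun N => ?_,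
    summable_of_sum_range_le (c := S 0 + ε * D0 + (C + 1 / 2) * a2) hG fun N => ?_⟩
  · refine (hext (fun k => sq_nonneg (D k)) N).trans ((hDsum N).trans ?_)
    gcongr
    have hXs : ∑ s ∈ Finset.range (N + T), X s =
        ∑ k ∈ Finset.range (N + T), Q k + ∑ k ∈ Finset.range (N + T), A k ^ 2 :=
      Finset.sum_add_distrib
    linarith [hmain N, hA2 (N + T), hGn (N + T)]
  · linarith [hext hG N, hmain N, hQn (N + T)]

/-- If `∑ α = ∞` and `∑ α u < ∞` with `u ≥ 0`, then `u` is arbitrarily small infinitely often. -/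
theorem frequently_lt_of_summable_mul {α u : ℕ → ℝ} (hα : ∀ k, 0 ≤ α k)
    (hαsum : Tendsto (fun K : ℕ => ∑ k ∈ Finset.range K, α k) atTop atTop)
    (hsum : Summable fun k => α k * u k) {ε : ℝ} (hε : 0 < ε) : ∃ᶠ k in atTop, u k < ε := by
  intro hev
  have hev' : ∀ᶠ k in atTop, ‖α k‖ ≤ ε⁻¹ * (α k * u k) := by
    filter_upwards [hev] with k hk
    rw [Real.norm_of_nonneg (hα k), inv_mul_eq_div, le_div_iff₀ hε]
    exact mul_le_mul_of_nonneg_left (not_lt.1 hk) (hα k)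
  have hs : Summable α := (hsum.mul_left ε⁻¹).of_norm_bounded_eventually_nat hev'
  exact not_tendsto_nhds_of_tendsto_atTop hαsum _ hs.hasSum.tendsto_sum_nat

/-! ### Disagreement along a connected graph -/

/-- Each weight is at most one and is dropped, so the bound is uniform in time-varying weights. -/
theorem norm_weight_sum_sub_le {ι V : Type*} [Fintype ι] [NormedAddCommGroup V]
    [NormedSpace ℝ V] {a : ι → ℝ} (ha : ∀ j, 0 ≤ a j) (ha1 : ∑ j, a j = 1) (x : ι → V) (w : V) :
    ‖∑ j, a j • x j - w‖ ≤ ∑ j, ‖x j - w‖ := by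
  have h1 : ∑ j, a j • x j - w = ∑ j, a j • (x j - w) := by
    simp only [smul_sub]
    rw [Finset.sum_sub_distrib, ← Finset.sum_smul, ha1, one_smul]
  rw [h1]
  refine (norm_sum_le _ _).trans (Finset.sum_le_sum fun j _ => ?_)
  rw [norm_smul, Real.norm_of_nonneg (ha j)]
  refine mul_le_of_le_one_left (norm_nonneg _) ?_
  rw [← ha1]
  exact Finset.single_le_sum (f := a) (fun l _ => ha l) (Finset.mem_univ j)

/-- If every point moves by at most `R s` at time `s` and the endpoints of every edge come close
to each other in every time window of length `T`, then at the end of a window the distance of two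
connected points is bounded by the sum of `R` over the window. -/
theorem exists_norm_sub_le_window {ι V : Type*} [NormedAddCommGroup V]
    {z : ℕ → ι → V} {R : ℕ → ℝ} {T : ℕ} {N : ι → ι → Prop} (hR : ∀ k, 0 ≤ R k)
    (hmove : ∀ s i, ‖z s i - z (s + 1) i‖ ≤ R s)
    (hedge : ∀ j i, N j i → ∀ t, ∃ s, t ≤ s ∧ s < t + T ∧ ‖z s j - z s i‖ ≤ 2 * R s)
    {j i : ι} (hji : Relation.ReflTransGen N j i) :
    ∃ M : ℝ, 0 ≤ M ∧ ∀ k, ‖z (k + T) j - z (k + T) i‖ ≤ M * ∑ u ∈ Finset.range T, R (k + u) := by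
  induction hji with
  | refl => exact ⟨0, le_rfl, fun k => by simp⟩
  | @tail l i _ hli ih =>
    obtain ⟨M, hM, hk⟩ := ih
    -- Appending an edge costs four window sums: the drifts of `l` and `i` from time `s` to `k + T`,
    -- and `2 * R s` for their distance at time `s`.
    refine ⟨M + 4, by linarith, fun k => ?_⟩
    obtain ⟨s, hks, hsT, hs⟩ := hedge l i hli k
    have hW : ∑ u ∈ Finset.range T, R (k + u) = ∑ s ∈ Finset.Ico k (k + T), R s := by
      rw [Finset.sum_Ico_eq_sum_range, Nat.add_sub_cancel_left]
    have hstay : ∀ r, ‖z s r - z (k + T) r‖ ≤ ∑ u ∈ Finset.range T, R (k + u) := by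
      intro r
      rw [← dist_eq_norm, hW]
      refine (dist_le_Ico_sum_of_dist_le (f := fun t => z t r) hsT.le (d := R)
        fun {t} _ _ => ?_).trans ?_
      · rw [dist_eq_norm]
        exact hmove t r
      · exact Finset.sum_le_sum_of_subset_of_nonneg (Finset.Ico_subset_Ico_left hks)
          fun t _ _ => hR t
    have hRs : R s ≤ ∑ u ∈ Finset.range T, R (k + u) := by
      rw [hW]
      exact Finset.single_le_sum (fun t _ => hR t) (Finset.mem_Ico.2 ⟨hks, hsT⟩)
    have hsplit : z (k + T) j - z (k + T) i = (z (k + T) j - z (k + T) l)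
        + (-(z s l - z (k + T) l) + (z s l - z s i) + (z s i - z (k + T) i)) := by abel
    have h1 := norm_add_le (z (k + T) j - z (k + T) l)
      (-(z s l - z (k + T) l) + (z s l - z s i) + (z s i - z (k + T) i))
    have h2 := norm_add₃_le (a := -(z s l - z (k + T) l)) (b := z s l - z s i)
      (c := z s i - z (k + T) i)
    rw [norm_neg] at h2
    rw [hsplit]
    linarith [hk k, hstay l, hstay i]

/-! ### The projected subgradient method with averaging -/

section ProjectedConsensus

variable {ι V : Type*} [Fintype ι] [NormedAddCommGroup V] [InnerProductSpace ℝ V]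

/-- The decrease of the squared distances to a point in one step of the projected (sub)gradient
method with averaging, all agents using the sum of the subgradients at their points. -/
theorem projected_consensus_energy {Z : Set V} (hZ : Convex ℝ Z) {f : ι → V → ℝ}
    {d : ι → V → V} {L : ℝ} (hd : ∀ i x w, f i x + inner ℝ (d i x) (w - x) ≤ f i w)
    (hL : ∀ i, ∀ x ∈ Z, ‖d i x‖ ≤ L) (hL0 : 0 ≤ L)
    {a : ι → ι → ℝ} (ha : ∀ i j, 0 ≤ a i j) (harow : ∀ i, ∑ j, a i j = 1)
    (hacol : ∀ j, ∑ i, a i j = 1) {α : ι → ℝ} (hα : ∀ i, 0 ≤ α i)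
    {x y : ι → V} (hx : ∀ i, x i ∈ Z)
    (hy : ∀ i, ∀ w ∈ Z, ‖y i - w‖ ≤ ‖∑ j, a i j • x j - α i • ∑ j, d j (x j) - w‖)
    {w : V} (hw : w ∈ Z) :
    ∑ i, ‖y i - w‖ ^ 2 + ∑ i, ∑ j, a i j * ‖x j - ∑ l, a i l • x l‖ ^ 2
        + 2 * ∑ i, α i * (∑ j, f j (∑ l, a i l • x l) - ∑ j, f j w) ≤
      ∑ i, ‖x i - w‖ ^ 2 + 4 * (Fintype.card ι * L) * ((∑ i, α i) * ∑ i, ∑ j, ‖x i - x j‖)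
        + (Fintype.card ι * L) ^ 2 * (∑ i, α i) ^ 2 := by
  set v : ι → V := fun i => ∑ l, a i l • x l with hv
  set g : V := ∑ j, d j (x j) with hg
  set D : ℝ := ∑ i, ∑ j, ‖x i - x j‖ with hD
  have hvZ : ∀ i, v i ∈ Z := fun i =>
    hZ.sum_mem (fun j _ => ha i j) (harow i) fun j _ => hx j
  have hgn : ‖g‖ ≤ Fintype.card ι * L := by
    refine (norm_sum_le_of_le _ fun j _ => hL j _ (hx j)).trans ?_
    simp
  have hxv : ∀ i j, ‖x j - v i‖ ≤ D := by
    intro i j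
    rw [norm_sub_rev]
    refine (norm_weight_sum_sub_le (ha i) (harow i) x (x j)).trans ?_
    rw [hD, Finset.sum_comm]
    exact Finset.single_le_sum (f := fun j => ∑ i, ‖x i - x j‖)
      (fun l _ => Finset.sum_nonneg fun r _ => norm_nonneg _) (Finset.mem_univ j)
  have hinner : ∀ i, ∑ j, f j (v i) - ∑ j, f j w - 2 * (Fintype.card ι * L) * D
      ≤ inner ℝ g (v i - w) := by
    intro i
    -- The subgradient is taken at `x j` instead of `v i`. One `L * D` pays for replacing `v i` by
    -- `x j` in the inner product, the other for replacing `f j (x j)` by `f j (v i)`.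
    have hj : ∀ j, f j (v i) - f j w - 2 * L * D ≤ inner ℝ (d j (x j)) (v i - w) := by
      intro j
      have h1 := hd j (x j) w
      have h2 := hd j (v i) (x j)
      have h3 : ∀ u ∈ Z, |inner ℝ (d j u) (x j - v i)| ≤ L * D := fun u hu =>
        (abs_real_inner_le_norm _ _).trans
          (mul_le_mul (hL j u hu) (hxv i j) (norm_nonneg _) hL0)
      have h4 := abs_le.1 (h3 _ (hvZ i))
      have h5 := abs_le.1 (h3 _ (hx j))
      have h6 : inner ℝ (d j (x j)) (v i - w) =
          - inner ℝ (d j (x j)) (x j - v i) - inner ℝ (d j (x j)) (w - x j) := by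
        rw [← inner_neg_right, ← inner_sub_right]
        congr 1
        abel
      linarith [h4.1, h5.2]
    rw [hg, sum_inner]
    refine le_trans (le_of_eq ?_) (Finset.sum_le_sum fun j _ => hj j)
    rw [Finset.sum_sub_distrib, Finset.sum_sub_distrib]
    simp
    ring
  have hstep : ∀ i, ‖y i - w‖ ^ 2 + ∑ j, a i j * ‖x j - v i‖ ^ 2
      + 2 * (α i * (∑ j, f j (v i) - ∑ j, f j w)) ≤
      ∑ j, a i j * ‖x j - w‖ ^ 2 + 4 * (Fintype.card ι * L) * D * α i
        + (Fintype.card ι * L) ^ 2 * α i ^ 2 := by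
    intro i
    rw [sum_weight_mul_norm_sub_sq (a i) (harow i) x w]
    have h1 : ‖y i - w‖ ^ 2 ≤ ‖(v i - w) - α i • g‖ ^ 2 := by
      have h := hy i w hw
      rw [sub_right_comm] at h
      gcongr
    rw [norm_sub_sq_real (v i - w), inner_smul_right, norm_smul, Real.norm_of_nonneg (hα i),
      real_inner_comm, mul_pow] at h1
    have h2 := mul_le_mul_of_nonneg_left (hinner i) (hα i)
    have h3 : ‖g‖ ^ 2 ≤ (Fintype.card ι * L) ^ 2 := by gcongr
    have h4 := mul_le_mul_of_nonneg_left h3 (sq_nonneg (α i))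
    change _ ≤ ‖v i - w‖ ^ 2 + ∑ j, a i j * ‖x j - v i‖ ^ 2 + _ + _
    linarith
  have hsum := Finset.sum_le_sum fun i (_ : i ∈ Finset.univ) => hstep i
  simp only [Finset.sum_add_distrib] at hsum
  -- After exchanging the sums, the unit column sums turn the averaged squared distances back into
  -- `∑ j, ‖x j - w‖ ^ 2`.
  rw [← Finset.mul_sum, ← Finset.mul_sum, ← Finset.mul_sum, Finset.sum_comm (γ := ι)
    (f := fun i j => a i j * ‖x j - w‖ ^ 2)] at hsum
  simp only [← Finset.sum_mul, hacol, one_mul] at hsum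
  have hsq : ∑ i, α i ^ 2 ≤ (∑ i, α i) ^ 2 := Finset.sum_sq_le_sq_sum_of_nonneg fun i _ => hα i
  have := mul_le_mul_of_nonneg_left hsq (sq_nonneg (Fintype.card ι * L))
  linarith

/-- In the projected (sub)gradient method with averaging, the squared disagreement is controlled
by the variance terms and the step sizes in the preceding time window. -/
theorem projected_consensus_window {Z : Set V} (hZ : Convex ℝ Z) {K : ℝ}
    {a : ℕ → ι → ι → ℝ} (ha : ∀ k i j, 0 ≤ a k i j) (harow : ∀ k i, ∑ j, a k i j = 1)
    {η : ℝ} (hη : 0 < η) (hdiag : ∀ k i, η ≤ a k i i) {N : ι → ι → Prop} {T : ℕ}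
    (hedge : ∀ j i, N j i → ∀ t, ∃ s, t ≤ s ∧ s < t + T ∧ η ≤ a s i j)
    (hN : ∀ j i, Relation.ReflTransGen N j i)
    {α : ℕ → ι → ℝ} (hα : ∀ k i, 0 ≤ α k i)
    {z : ℕ → ι → V} (hz : ∀ k i, z k i ∈ Z) {g : ℕ → V} (hg : ∀ k, ‖g k‖ ≤ K)
    (hstep : ∀ k i, ∀ w ∈ Z, ‖z (k + 1) i - w‖ ≤ ‖∑ j, a k i j • z k j - α k i • g k - w‖) :
    ∃ M : ℝ, 0 ≤ M ∧ ∀ k, (∑ i, ∑ j, ‖z (k + T) i - z (k + T) j‖) ^ 2 ≤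
      M * ∑ u ∈ Finset.range T,
        (∑ i, ∑ j, a (k + u) i j * ‖z (k + u) j - ∑ l, a (k + u) i l • z (k + u) l‖ ^ 2
          + (∑ i, α (k + u) i) ^ 2) := by
  set v : ℕ → ι → V := fun k i => ∑ l, a k i l • z k l with hv
  set Q : ℕ → ℝ := fun k => ∑ i, ∑ j, a k i j * ‖z k j - v k i‖ ^ 2 with hQ
  set A : ℕ → ℝ := fun k => ∑ i, α k i with hA
  have hK : 0 ≤ K := (norm_nonneg _).trans (hg 0)
  have hA0 : ∀ k, 0 ≤ A k := fun k => Finset.sum_nonneg fun i _ => hα k i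
  have hterm : ∀ k i j, 0 ≤ a k i j * ‖z k j - v k i‖ ^ 2 := fun k i j =>
    mul_nonneg (ha k i j) (sq_nonneg _)
  have hQ0 : ∀ k, 0 ≤ Q k := fun k =>
    Finset.sum_nonneg fun i _ => Finset.sum_nonneg fun j _ => hterm k i j
  -- Bounds one move: a weight of at least `η` keeps a point within `√(Q / η)` of the mean, and the
  -- gradient step adds at most `K * A`.
  set R : ℕ → ℝ := fun k => √(Q k / η) + K * A k with hR
  have hR0 : ∀ k, 0 ≤ R k := fun k =>
    add_nonneg (Real.sqrt_nonneg _) (mul_nonneg hK (hA0 k))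
  have hnear : ∀ k i j, η ≤ a k i j → ‖z k j - v k i‖ ≤ √(Q k / η) := by
    intro k i j h
    refine Real.le_sqrt_of_sq_le ?_
    rw [le_div_iff₀ hη, mul_comm]
    calc η * ‖z k j - v k i‖ ^ 2 ≤ a k i j * ‖z k j - v k i‖ ^ 2 := by gcongr
      _ ≤ ∑ j, a k i j * ‖z k j - v k i‖ ^ 2 :=
        Finset.single_le_sum (fun j _ => hterm k i j) (Finset.mem_univ j)
      _ ≤ Q k := Finset.single_le_sum (f := fun i => ∑ j, a k i j * ‖z k j - v k i‖ ^ 2)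
        (fun i _ => Finset.sum_nonneg fun j _ => hterm k i j) (Finset.mem_univ i)
  have hmove : ∀ k i, ‖z k i - z (k + 1) i‖ ≤ R k := by
    intro k i
    have hvZ : v k i ∈ Z := hZ.sum_mem (fun j _ => ha k i j) (harow k i) fun j _ => hz k j
    -- With the mean itself as the test point in `Z`, only the gradient displacement remains.
    have h1 : ‖z (k + 1) i - v k i‖ ≤ K * A k := by
      refine (hstep k i _ hvZ).trans ?_
      rw [sub_right_comm, sub_self, zero_sub, norm_neg, norm_smul, Real.norm_of_nonneg (hα k i),
        mul_comm]
      exact mul_le_mul (hg k) (Finset.single_le_sum (f := α k) (fun i _ => hα k i)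
        (Finset.mem_univ i)) (hα k i) hK
    calc ‖z k i - z (k + 1) i‖ ≤ ‖z k i - v k i‖ + ‖v k i - z (k + 1) i‖ :=
          norm_sub_le_norm_sub_add_norm_sub _ _ _
      _ ≤ R k := add_le_add (hnear k i i (hdiag k i)) (by rwa [norm_sub_rev])
  -- Both endpoints are close to the mean formed by the receiving agent `i`.
  have hclose : ∀ j i, N j i → ∀ t, ∃ s, t ≤ s ∧ s < t + T ∧ ‖z s j - z s i‖ ≤ 2 * R s := by
    intro j i hji t
    obtain ⟨s, hts, hsT, hs⟩ := hedge j i hji t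
    refine ⟨s, hts, hsT, ?_⟩
    have h1 := norm_sub_le_norm_sub_add_norm_sub (z s j) (v s i) (z s i)
    rw [norm_sub_rev (v s i)] at h1
    have h2 : √(Q s / η) ≤ R s := le_add_of_nonneg_right (mul_nonneg hK (hA0 s))
    linarith [hnear s i j hs, hnear s i i (hdiag s i)]
  choose M hM hMk using fun i j => exists_norm_sub_le_window hR0 hmove hclose (hN i j)
  set M' := ∑ i, ∑ j, M i j with hM'
  set C := max (2 / η) (2 * K ^ 2) with hC
  have hC0 : 0 ≤ C := le_max_of_le_left (by positivity)
  refine ⟨M' ^ 2 * T * C, by positivity, fun k => ?_⟩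
  have hR2 : ∀ s, R s ^ 2 ≤ C * (Q s + A s ^ 2) := by
    intro s
    have h1 : R s ^ 2 ≤ 2 * (√(Q s / η) ^ 2 + (K * A s) ^ 2) := add_sq_le
    rw [Real.sq_sqrt (div_nonneg (hQ0 s) hη.le)] at h1
    have h2 := mul_le_mul_of_nonneg_right (le_max_left (2 / η) (2 * K ^ 2)) (hQ0 s)
    have h3 := mul_le_mul_of_nonneg_right (le_max_right (2 / η) (2 * K ^ 2)) (sq_nonneg (A s))
    have h4 : 2 * (Q s / η) = 2 / η * Q s := by ring
    rw [← hC] at h2 h3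
    linarith
  calc (∑ i, ∑ j, ‖z (k + T) i - z (k + T) j‖) ^ 2
      ≤ (M' * ∑ u ∈ Finset.range T, R (k + u)) ^ 2 := by
        refine pow_le_pow_left₀ (Finset.sum_nonneg fun i _ =>
          Finset.sum_nonneg fun j _ => norm_nonneg _) ?_ 2
        simp only [hM', Finset.sum_mul]
        refine Finset.sum_le_sum fun i _ => Finset.sum_le_sum fun j _ => ?_
        exact hMk i j k
    _ ≤ M' ^ 2 * (T * ∑ u ∈ Finset.range T, R (k + u) ^ 2) := by
        rw [mul_pow]
        gcongr
        simpa using sq_sum_le_card_mul_sum_sq (s := Finset.range T) (f := fun u => R (k + u))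
    _ ≤ M' ^ 2 * (T * ∑ u ∈ Finset.range T, C * (Q (k + u) + A (k + u) ^ 2)) := by
        gcongr
        exact hR2 _
    _ = _ := by
        rw [← Finset.mul_sum]
        ring

/-- Convergence of the projected (sub)gradient method with averaging to a common minimizer. -/
theorem projected_consensus_tendsto [Nonempty ι] [FiniteDimensional ℝ V]
    {Z : Set V} (hZc : IsClosed Z) (hZ : Convex ℝ Z) {f : ι → V → ℝ}
    (hfc : ∀ i, Continuous (f i)) {d : ι → V → V} {L : ℝ}
    (hd : ∀ i x w, f i x + inner ℝ (d i x) (w - x) ≤ f i w)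
    (hL : ∀ i, ∀ x ∈ Z, ‖d i x‖ ≤ L) (hL0 : 0 ≤ L)
    {w : V} (hw : w ∈ Z) (hwmin : ∀ x ∈ Z, ∑ i, f i w ≤ ∑ i, f i x)
    {a : ℕ → ι → ι → ℝ} (ha : ∀ k i j, 0 ≤ a k i j) (harow : ∀ k i, ∑ j, a k i j = 1)
    (hacol : ∀ k j, ∑ i, a k i j = 1)
    {η : ℝ} (hη : 0 < η) (hdiag : ∀ k i, η ≤ a k i i) {N : ι → ι → Prop} {T : ℕ}
    (hedge : ∀ j i, N j i → ∀ t, ∃ s, t ≤ s ∧ s < t + T ∧ η ≤ a s i j)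
    (hN : ∀ j i, Relation.ReflTransGen N j i)
    {α : ℕ → ι → ℝ} (hα : ∀ k i, 0 ≤ α k i)
    (hαsum : ∀ i, Tendsto (fun K : ℕ => ∑ k ∈ Finset.range K, α k i) atTop atTop)
    (hαsq : ∀ i, Summable fun k => α k i ^ 2)
    {z : ℕ → ι → V} (hz : ∀ k i, z k i ∈ Z)
    (hstep : ∀ k i, ∀ w ∈ Z, ‖z (k + 1) i - w‖ ≤
      ‖∑ j, a k i j • z k j - α k i • ∑ j, d j (z k j) - w‖) :
    ∃ x ∈ Z, (∀ y ∈ Z, ∑ i, f i x ≤ ∑ i, f i y) ∧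
      ∀ i, Tendsto (fun k => ‖z k i - x‖) atTop (𝓝 0) := by
  set m : ℝ := (Fintype.card ι : ℝ) with hm
  set v : ℕ → ι → V := fun k i => ∑ l, a k i l • z k l with hv
  set Q : ℕ → ℝ := fun k => ∑ i, ∑ j, a k i j * ‖z k j - v k i‖ ^ 2 with hQ
  set A : ℕ → ℝ := fun k => ∑ i, α k i with hA
  set D : ℕ → ℝ := fun k => ∑ i, ∑ j, ‖z k i - z k j‖ with hD
  have hvZ : ∀ k i, v k i ∈ Z := fun k i =>
    hZ.sum_mem (fun j _ => ha k i j) (harow k i) fun j _ => hz k j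
  have hA0 : ∀ k, 0 ≤ A k := fun k => Finset.sum_nonneg fun i _ => hα k i
  have hD0 : ∀ k, 0 ≤ D k := fun k =>
    Finset.sum_nonneg fun i _ => Finset.sum_nonneg fun j _ => norm_nonneg _
  have hQ0 : ∀ k, 0 ≤ Q k := fun k => Finset.sum_nonneg fun i _ =>
    Finset.sum_nonneg fun j _ => mul_nonneg (ha k i j) (sq_nonneg _)
  have hAsq : Summable fun k => A k ^ 2 := by
    refine Summable.of_nonneg_of_le (fun k => sq_nonneg _) (fun k => ?_)
      ((summable_sum fun i (_ : i ∈ Finset.univ) => hαsq i).mul_left m)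
    simpa using sq_sum_le_card_mul_sum_sq (s := Finset.univ) (f := α k)
  obtain ⟨M, hM, hwindow⟩ := projected_consensus_window hZ (K := m * L) ha harow hη hdiag hedge hN hα
    hz (g := fun k => ∑ j, d j (z k j))
    (fun k => (norm_sum_le_of_le _ fun j _ => hL j _ (hz k j)).trans (by simp [hm])) hstep
  set c : ℝ := 4 * (m * L) + (m * L) ^ 2 with hc
  have hmL : 0 ≤ m * L := by positivity
  have hc0 : 0 ≤ c := by positivity
  have henergy : ∀ x ∈ Z, ∀ k, ∑ i, ‖z (k + 1) i - x‖ ^ 2 + Q k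
      + 2 * ∑ i, α k i * (∑ j, f j (v k i) - ∑ j, f j x) ≤
      ∑ i, ‖z k i - x‖ ^ 2 + c * (A k * D k) + c * A k ^ 2 := by
    intro x hx k
    have h := projected_consensus_energy hZ hd hL hL0 (ha k) (harow k) (hacol k) (hα k) (hz k)
      (hstep k) hx
    have h1 : 0 ≤ (m * L) ^ 2 * (A k * D k) := mul_nonneg (sq_nonneg _)
      (mul_nonneg (hA0 k) (hD0 k))
    have h2 : 0 ≤ 4 * (m * L) * A k ^ 2 := mul_nonneg (by positivity) (sq_nonneg _)
    change _ ≤ _ + 4 * (m * L) * (A k * D k) + (m * L) ^ 2 * A k ^ 2 at h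
    rw [hc, add_mul, add_mul]
    linarith
  have hG0 : ∀ x ∈ Z, (∀ y ∈ Z, ∑ i, f i x ≤ ∑ i, f i y) → ∀ k i,
      0 ≤ α k i * (∑ j, f j (v k i) - ∑ j, f j x) := fun x hx hmin k i =>
    mul_nonneg (hα k i) (sub_nonneg.2 (hmin _ (hvZ k i)))
  -- `hDsq` does not involve `w`, so it serves every other minimizer as well.
  obtain ⟨hDsq, hGsum⟩ := summable_of_energy_inequality (S := fun k => ∑ i, ‖z k i - w‖ ^ 2)
    (fun k => Finset.sum_nonneg fun i _ => sq_nonneg _) hQ0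
    (fun k => mul_nonneg zero_le_two (Finset.sum_nonneg fun i _ => hG0 w hw hwmin k i))
    hc0 hM hAsq (henergy w hw) hwindow
  -- Needed for all minimizers, because the limit point found below is not known in advance.
  have hconv : ∀ x ∈ Z, (∀ y ∈ Z, ∑ i, f i x ≤ ∑ i, f i y) →
      ∃ l, Tendsto (fun k => ∑ i, ‖z k i - x‖ ^ 2) atTop (𝓝 l) := by
    intro x hx hmin
    refine exists_tendsto_of_le_add_summable (b := fun k => c * (D k ^ 2 + 2 * A k ^ 2))
      (fun k => Finset.sum_nonneg fun i _ => sq_nonneg _)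
      ((hDsq.add (hAsq.mul_left 2)).mul_left c) fun k => ?_
    have h1 := Finset.sum_nonneg fun i (_ : i ∈ Finset.univ) => hG0 x hx hmin k i
    have h2 : A k * D k ≤ D k ^ 2 + A k ^ 2 := by nlinarith [sq_nonneg (A k - D k)]
    have h3 := mul_le_mul_of_nonneg_left h2 hc0
    linarith [henergy x hx k, hQ0 k]
  obtain ⟨i₀⟩ := ‹Nonempty ι›
  -- One agent suffices: the others share its limit points since `D` tends to zero.
  have hfreq : ∀ n : ℕ, ∃ᶠ k in atTop,
      ∑ j, f j (v k i₀) - ∑ j, f j w < 1 / ((n : ℝ) + 1) := by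
    intro n
    refine frequently_lt_of_summable_mul (fun k => hα k i₀) (hαsum i₀) ?_
      Nat.one_div_pos_of_nat
    refine Summable.of_nonneg_of_le (fun k => hG0 w hw hwmin k i₀) (fun k => ?_) hGsum
    have h := Finset.single_le_sum (fun i _ => hG0 w hw hwmin k i) (Finset.mem_univ i₀)
    linarith [hG0 w hw hwmin k i₀]
  obtain ⟨φ, hφ, hφlt⟩ := extraction_forall_of_frequently hfreq
  obtain ⟨l, hl⟩ := hconv w hw hwmin
  obtain ⟨B, hB⟩ := hl.bddAbove_range
  have hzb : ∀ k, z (φ k) i₀ ∈ Metric.closedBall w √B := by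
    intro k
    rw [Metric.mem_closedBall, dist_eq_norm]
    refine Real.le_sqrt_of_sq_le (le_trans ?_ (hB ⟨φ k, rfl⟩))
    exact Finset.single_le_sum (f := fun i => ‖z (φ k) i - w‖ ^ 2)
      (fun i _ => sq_nonneg _) (Finset.mem_univ i₀)
  have : ProperSpace V := FiniteDimensional.proper_real V
  obtain ⟨x, -, ψ, hψ, hlim⟩ := (isCompact_closedBall w √B).tendsto_subseq hzb
  have hxZ : x ∈ Z := hZc.mem_of_tendsto hlim (Eventually.of_forall fun k => hz _ _)
  have hθ : Tendsto (φ ∘ ψ) atTop atTop := hφ.tendsto_atTop.comp hψ.tendsto_atTop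
  have hDlim : Tendsto D atTop (𝓝 0) := by
    have h := (Real.continuous_sqrt.tendsto _).comp hDsq.tendsto_atTop_zero
    rw [Real.sqrt_zero] at h
    exact h.congr fun k => Real.sqrt_sq (hD0 k)
  have hpair : ∀ k i j, ‖z k i - z k j‖ ≤ D k := fun k i j =>
    (Finset.single_le_sum (f := fun j => ‖z k i - z k j‖) (fun j _ => norm_nonneg _)
      (Finset.mem_univ j)).trans
    (Finset.single_le_sum (f := fun i => ∑ j, ‖z k i - z k j‖)
      (fun i _ => Finset.sum_nonneg fun j _ => norm_nonneg _) (Finset.mem_univ i))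
  have hzlim : ∀ i, Tendsto (fun k => z ((φ ∘ ψ) k) i) atTop (𝓝 x) := by
    intro i
    have h : Tendsto (fun k => z ((φ ∘ ψ) k) i - z ((φ ∘ ψ) k) i₀) atTop (𝓝 0) :=
      squeeze_zero_norm (fun k => hpair _ i i₀) (hDlim.comp hθ)
    simpa using h.add hlim
  have hvlim : Tendsto (fun k => v ((φ ∘ ψ) k) i₀) atTop (𝓝 x) := by
    have h0 : Tendsto (fun k => ∑ j, ‖z ((φ ∘ ψ) k) j - x‖) atTop (𝓝 0) := by
      simpa using tendsto_finsetSum Finset.univ fun j _ =>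
        tendsto_iff_norm_sub_tendsto_zero.1 (hzlim j)
    exact tendsto_iff_norm_sub_tendsto_zero.2 (squeeze_zero (fun k => norm_nonneg _)
      (fun k => norm_weight_sum_sub_le (ha _ i₀) (harow _ i₀) _ x) h0)
  have hFx : ∑ j, f j x ≤ ∑ j, f j w := by
    have h1 : Tendsto (fun k => ∑ j, f j (v ((φ ∘ ψ) k) i₀) - ∑ j, f j w) atTop
        (𝓝 (∑ j, f j x - ∑ j, f j w)) :=
      (tendsto_finsetSum _ fun j _ => ((hfc j).tendsto x).comp hvlim).sub_const _
    have h2 := (tendsto_one_div_add_atTop_nhds_zero_nat (𝕜 := ℝ)).comp hψ.tendsto_atTop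
    have := le_of_tendsto_of_tendsto' h1 h2 fun k => (hφlt (ψ k)).le
    linarith
  have hxmin : ∀ y ∈ Z, ∑ i, f i x ≤ ∑ i, f i y := fun y hy => hFx.trans (hwmin y hy)
  refine ⟨x, hxZ, hxmin, fun i => ?_⟩
  obtain ⟨l', hl'⟩ := hconv x hxZ hxmin
  have hsub : Tendsto (fun k => ∑ i, ‖z ((φ ∘ ψ) k) i - x‖ ^ 2) atTop (𝓝 0) := by
    simpa using tendsto_finsetSum Finset.univ fun j _ =>
      (tendsto_iff_norm_sub_tendsto_zero.1 (hzlim j)).pow 2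
  -- The full sequence of squared distances converges, so its limit is the subsequential one, zero.
  rw [tendsto_nhds_unique (hl'.comp hθ) hsub] at hl'
  have h := (Real.continuous_sqrt.tendsto _).comp hl'
  rw [Real.sqrt_zero] at h
  refine squeeze_zero (fun k => norm_nonneg _) (fun k => Real.le_sqrt_of_sq_le ?_) h
  exact Finset.single_le_sum (f := fun i => ‖z k i - x‖ ^ 2)
    (fun i _ => sq_nonneg _) (Finset.mem_univ i)

end ProjectedConsensus

/-! ### Application to the quadratic design program -/

/-- The gradient of a convex function is a subgradient. -/
theorem ConvexOn.gradient_mem_subgradients {n : ℕ} {f : DesignVec n → ℝ} {x g : DesignVec n}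
    (hf : ConvexOn ℝ Set.univ f) (hg : HasGradientAt f g x) : g ∈ subgradients f x := by
  intro w
  have hline : ConvexOn ℝ Set.univ (f ∘ AffineMap.lineMap (k := ℝ) x w) := by
    simpa using hf.comp_affineMap (AffineMap.lineMap (k := ℝ) x w)
  have hderiv : HasDerivAt (f ∘ AffineMap.lineMap (k := ℝ) x w) (inner ℝ g (w - x)) 0 := by
    have hl : HasDerivAt (AffineMap.lineMap (k := ℝ) x w) (w - x) 0 := AffineMap.hasDerivAt_lineMap
    have hg' : HasFDerivAt f (InnerProductSpace.toDual ℝ (DesignVec n) g)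
        (AffineMap.lineMap (k := ℝ) x w 0) := by
      rw [AffineMap.lineMap_apply_zero]
      exact hg.hasFDerivAt
    simpa using hg'.comp_hasDerivAt 0 hl
  have h := hline.le_slope_of_hasDerivAt (Set.mem_univ 0) (Set.mem_univ 1) one_pos hderiv
  simp only [slope_def_field, Function.comp_apply, AffineMap.lineMap_apply_zero,
    AffineMap.lineMap_apply_one, sub_zero, div_one] at h
  linarith

/-- Boundedness of the gradients on a nonempty closed set forces the design program to have a
minimizer on it: either the local objectives are constant or the set is compact. -/
theorem SpecialQDP.exists_minimizer {m n p : ℕ} (P : SpecialQDP m n p) (k : ℕ)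
    {Z : Set (DesignVec n)} (hZ : IsClosed Z) (hne : Z.Nonempty) {L : ℝ}
    (hL : ∀ i, ∀ x ∈ Z, ‖gradient (P.localObjective k i) x‖ ≤ L) :
    ∃ w ∈ Z, ∀ x ∈ Z, ∑ i, P.localObjective k i w ≤ ∑ i, P.localObjective k i x := by
  by_cases h : ∃ i, P.c k i ≠ 0 ∧ P.bPrime k i ≠ 0
  · obtain ⟨i, hc, hb⟩ := h
    have hs : 0 < ‖2 * P.c k i * P.bPrime k i‖ := norm_pos_iff.2 (by simp [hc, hb])
    -- The gradient is affine in `x` with linear part a nonzero multiple of the identity, so its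
    -- bound on `Z` bounds `Z`.
    have hbdd : Bornology.IsBounded Z := by
      refine isBounded_iff_forall_norm_le.2
        ⟨(L / ‖2 * P.c k i * P.bPrime k i‖ + ‖P.t k i‖) / ‖P.bPrime k i‖, fun x hx => ?_⟩
      have h1 := hL i x hx
      rw [(P.hasGradientAt_localObjective k i x).gradient, norm_smul, mul_comm,
        ← le_div_iff₀ hs] at h1
      rw [le_div_iff₀ (norm_pos_iff.2 hb), mul_comm, ← norm_smul]
      calc ‖P.bPrime k i • x‖ = ‖(P.bPrime k i • x - P.t k i) + P.t k i‖ := by rw [sub_add_cancel]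
        _ ≤ _ := (norm_add_le _ _).trans (by linarith)
    have hcomp : IsCompact Z := Metric.isCompact_of_isClosed_isBounded hZ hbdd
    have hcont : Continuous fun x => ∑ i, P.localObjective k i x :=
      continuous_finsetSum _ fun j _ => continuous_iff_continuousAt.2 fun x =>
        (P.hasGradientAt_localObjective k j x).continuousAt
    obtain ⟨w, hw, hmin⟩ := hcomp.exists_isMinOn hne hcont.continuousOn
    exact ⟨w, hw, fun x hx => hmin hx⟩
  · push Not at h
    obtain ⟨w, hw⟩ := hne
    refine ⟨w, hw, fun x _ => le_of_eq (Finset.sum_congr rfl fun i _ => ?_)⟩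
    rw [P.localObjective_eq, P.localObjective_eq]
    by_cases hc : P.c k i = 0
    · simp [hc]
    · simp [h i hc]

/-- Under the weights rule and bounded intercommunication intervals, all edges that are used
infinitely often carry a weight bounded below in every time window of one common length. -/
theorem WeightsRule.exists_uniform_window {m : ℕ} {a : ℕ → Fin m → Fin m → ℝ}
    {E : ℕ → Fin m → Fin m → Prop} (hw : WeightsRule a E) (hb : BoundedIntercommunication E) :
    ∃ η : ℝ, 0 < η ∧ (∀ k i, η ≤ a k i i) ∧ ∃ T : ℕ, ∀ j i, edgesInfty E j i →
      ∀ t, ∃ s, t ≤ s ∧ s < t + T ∧ η ≤ a s i j := by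
  obtain ⟨η, hη, -, ha⟩ := hw
  have hB : ∀ j i, ∃ B : ℕ, edgesInfty E j i → ∀ t, ∃ s, t ≤ s ∧ s < t + B ∧ E s j i := by
    intro j i
    by_cases h : edgesInfty E j i
    · exact (hb j i h).imp fun B hB _ => hB
    -- Dummy length for pairs outside `E_∞`, so that all lengths can be summed into one window
    -- length.
    · exact ⟨0, fun h' => absurd h' h⟩
  choose B hB using hB
  refine ⟨η, hη, fun k i => (ha k i).1, ∑ j, ∑ i, B j i, fun j i hji t => ?_⟩
  obtain ⟨s, hts, hs, hE⟩ := hB j i hji t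
  have hle : B j i ≤ ∑ j, ∑ i, B j i :=
    (Finset.single_le_sum (f := B j) (fun _ _ => Nat.zero_le _) (Finset.mem_univ i)).trans
      (Finset.single_le_sum (f := fun j => ∑ i, B j i) (fun _ _ => Nat.zero_le _)
        (Finset.mem_univ j))
  refine ⟨s, hts, by omega, ?_⟩
  -- The edge rule speaks of distinct agents only; a loop is covered by the diagonal bound.
  rcases eq_or_ne j i with rfl | hne
  · exact (ha s j).1
  · exact ((ha s i).2.1 j hne).1 hE

theorem mainTheorem1 {m n p : ℕ} (P : SpecialQDP m n p)
    -- the local objectives and constraint sets of the problem, which do not depend on time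
    (f : Fin m → DesignVec n → ℝ) (Zs : Fin m → Set (DesignVec n))
    (hf : ∀ k i, P.localObjective k i = f i) (hZs : ∀ k i, P.constraintSet k i = Zs i)
    (hconv : ∀ i, ConvexOn ℝ Set.univ (f i))
    -- the network
    (a : ℕ → Fin m → Fin m → ℝ) (E : ℕ → Fin m → Fin m → Prop)
    (hweights : WeightsRule a E) (hconn : ConnectivitySymmetry a E)
    (hbounded : BoundedIntercommunication E) (hdoubly : DoublyStochasticWeights a)
    -- the constraint sets
    (hne : (⋂ i, Zs i).Nonempty) (hsame : SameConstraintSet f Zs)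
    -- the step sizes
    (α : ℕ → Fin m → ℝ) (hαpos : ∀ k i, 0 < α k i)
    (hαsum : ∀ i, Tendsto (fun K : ℕ => ∑ k ∈ Finset.range K, α k i) atTop atTop)
    (hαsq : ∀ i, Summable fun k => α k i ^ 2)
    -- the iterates
    (z : ℕ → Fin m → DesignVec n) (hz : P.IsGenerated a α z) :
    ∃ zstar : DesignVec n, (∀ k, zstar ∈ P.optimalSet k) ∧
      ∀ i, Tendsto (fun k => ‖z k i - zstar‖) atTop (𝓝 0) := by
  -- Without agents the feasible set is the whole space and the objective is zero, so any point is
  -- optimal.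
  rcases isEmpty_or_nonempty (Fin m) with hm | hm
  · exact ⟨0, fun k => by simp [SpecialQDP.optimalSet], fun i => hm.elim i⟩
  obtain ⟨Z, hZc, hZ, hZeq, L, hL0, hLs⟩ := hsame
  have hinter : ∀ k, ⋂ i, P.constraintSet k i = Z := fun k => by
    simp only [hZs, hZeq, Set.iInter_const]
  have hgrad : ∀ i x, HasGradientAt (f i) (gradient (f i) x) x := fun i x => by
    have h := P.hasGradientAt_localObjective 0 i x
    rw [hf] at h
    exact h.differentiableAt.hasGradientAt
  have hsub : ∀ i x, gradient (f i) x ∈ subgradients (f i) x := fun i x =>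
    (hconv i).gradient_mem_subgradients (hgrad i x)
  have hL : ∀ i, ∀ x ∈ Z, ‖gradient (f i) x‖ ≤ L := fun i x hx => hLs i x hx _ (hsub i x)
  have hZne : Z.Nonempty := by simpa only [hZeq, Set.iInter_const] using hne
  obtain ⟨w, hw, hwmin⟩ := P.exists_minimizer 0 hZc hZne (L := L) fun i => by
    rw [hf]
    exact hL i
  simp only [hf] at hwmin
  obtain ⟨η, hη, hdiag, T, hedge⟩ := hweights.exists_uniform_window hbounded
  rw [P.isGenerated_iff_gradient] at hz
  have hproj : ∀ k i, IsProjectionOnto Z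
      (∑ j, a k i j • z k j - α k i • ∑ j, gradient (f j) (z k j)) (z (k + 1) i) := by
    intro k i
    simpa only [hZs, hZeq, hf, one_smul] using hz k i
  -- Time is shifted by one: the initial points may lie outside `Z`, while all later iterates are
  -- projections onto it.
  obtain ⟨x, hxZ, hxmin, hlim⟩ := projected_consensus_tendsto hZc hZ
    (fun i => continuous_iff_continuousAt.2 fun x => (hgrad i x).continuousAt) hsub hL hL0.le
    hw hwmin (a := fun k => a (k + 1)) (fun k => hdoubly.1 _) (fun k => hdoubly.2.1 _)
    (fun k => hdoubly.2.2 _) hη (fun k => hdiag _) (N := edgesInfty E) (T := T)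
    (fun j i hji t => by
      obtain ⟨s, hts, hsT, hs⟩ := hedge j i hji (t + 1)
      obtain ⟨r, rfl⟩ : ∃ r, s = r + 1 := ⟨s - 1, by omega⟩
      exact ⟨r, by omega, by omega, hs⟩)
    hconn.1 (α := fun k => α (k + 1)) (fun k i => (hαpos _ i).le)
    (fun i => by
      refine (tendsto_atTop_add_const_right atTop (-α 0 i)
        ((hαsum i).comp (tendsto_add_atTop_nat 1))).congr fun K => ?_
      simp [Finset.sum_range_succ'])
    (fun i => (summable_nat_add_iff 1).2 (hαsq i)) (z := fun k => z (k + 1))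
    (fun k i => (hproj k i).1) (fun k i y hy => (hproj (k + 1) i).norm_sub_le hZ hy)
  refine ⟨x, fun k => ⟨(hinter k).symm ▸ hxZ, fun y hy => ?_⟩, fun i =>
    (tendsto_add_atTop_iff_nat 1).1 (hlim i)⟩
  rw [hinter] at hy
  simpa only [hf] using hxmin y hy
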